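/- Let $f:\{0,1\}^n\times\{0,1\}^m\to\{0,1\}$ be a partial or total Boolean function; Alice holds $x$ and Bob holds $y$. In a one-way quantum protocol with $a$ qubits, Alice sends Bob an $a$-qubit pure state $|\psi_x\rangle$, and Bob applies a two-outcome measurement (POVM) depending on $y$ and outputs 1 if it accepts and 0 otherwise. Let $Q^1(f)$ be the minimal $a$ for which some such protocol outputs $f(x,y)$ with probability at least $2/3$ for every $(x,y)$ in the domain of $f$. For an integer $w\ge 0$, let $\mathrm{QMA}^1_w(f)$ be the minimal $a$ for which there is a protocol in which Alice sends Bob an $a$-qubit pure state $|\psi_x\rangle$, Merlin sends Bob a $w$-qubit pure state $|\phi\rangle$, and Bob applies a two-outcome measurement (POVM) depending on $y$ to $|\psi_x\rangle\otimes|\phi\rangle$, such that for every $(x,y)$ in the domain of $f$: if $f(x,y)=1$, then there exists $|\phi\rangle$ for which Bob accepts with probability at least $2/3$; if $f(x,y)=0$, then for all $|\phi\rangle$ Bob accepts with probability at most $1/3$. Then there is a universal constant $C>0$ such that for all $n,m\ge 0$, all partial or total Boolean functions $f:\{0,1\}^n\times\{0,1\}^m\to\{0,1\}$ and all integers $w\ge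 2$, \[ Q^1(f)\le C\cdot \mathrm{QMA}^1_w(f)\cdot w\log^2 w. \] -/

import Mathlib

open scoped Matrix ComplexOrder

/-- Bit strings of length `n`; they also label the computational basis of `n` qubits. -/
abbrev Bits (n : ℕ) : Type := Fin n → Bool

/-- A possibly partial Boolean function of Alice's input `x` and Bob's input `y`:
`f x y = none` means that `f` is undefined at `(x, y)`. -/
abbrev PartialBoolFun (n m : ℕ) : Type := Bits n → Bits m → Option Bool

/-- `ψ` is a unit vector, given by its amplitudes in the orthonormal basis labelled by `ι`. -/
def IsPureState {ι : Type*} [Fintype ι] (ψ : ι → ℂ) : Prop :=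
  ∑ i, ‖ψ i‖ ^ 2 = 1

/-- `Γ` is the accepting operator of a two-outcome POVM `{Γ, I - Γ}`, i.e. `0 ≤ Γ ≤ I`. -/
def IsMeasurementOperator {ι : Type*} [Fintype ι] [DecidableEq ι] (Γ : Matrix ι ι ℂ) : Prop :=
  Γ.PosSemidef ∧ (1 - Γ).PosSemidef

/-- The probability `⟨ψ|Γ|ψ⟩` that the measurement `{Γ, I - Γ}` accepts the pure state `ψ`. -/
noncomputable def acceptProb {ι : Type*} [Fintype ι] (Γ : Matrix ι ι ℂ) (ψ : ι → ℂ) : ℝ :=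
  (star ψ ⬝ᵥ (Γ *ᵥ ψ)).re

/-- The product state `ψ ⊗ φ`. -/
def tensorState {ι κ : Type*} (ψ : ι → ℂ) (φ : κ → ℂ) : ι × κ → ℂ :=
  fun p => ψ p.1 * φ p.2

/-- A one-way quantum protocol without Merlin: on input `x` Alice sends the `a`-qubit state
`message x`; on input `y` Bob applies the measurement with accepting operator `measure y`,
and outputs 1 if it accepts and 0 otherwise. -/
structure OneWayProtocol (n m a : ℕ) where
  message : Bits n → (Bits a → ℂ)
  message_pure : ∀ x, IsPureState (message x)
  measure : Bits m → Matrix (Bits a) (Bits a) ℂ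
  measure_isMeasurement : ∀ y, IsMeasurementOperator (measure y)

/-- On every input where `f` is defined, Bob outputs `f x y` with probability at least `2/3`
(the probability of output 0 is `1 - acceptProb`). -/
def OneWayProtocol.Computes {n m a : ℕ} (P : OneWayProtocol n m a) (f : PartialBoolFun n m) :
    Prop :=
  ∀ x y,
    (f x y = some true → 2 / 3 ≤ acceptProb (P.measure y) (P.message x)) ∧
    (f x y = some false → 2 / 3 ≤ 1 - acceptProb (P.measure y) (P.message x))

/-- A one-way quantum protocol with Merlin: on input `x` Alice sends the `a`-qubit state
`message x`, Merlin sends a `w`-qubit state, and on input `y` Bob measures both messages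
jointly with accepting operator `measure y`. -/
structure MerlinProtocol (n m a w : ℕ) where
  message : Bits n → (Bits a → ℂ)
  message_pure : ∀ x, IsPureState (message x)
  measure : Bits m → Matrix (Bits a × Bits w) (Bits a × Bits w) ℂ
  measure_isMeasurement : ∀ y, IsMeasurementOperator (measure y)

/-- Completeness `2/3` (some witness, which may depend on `x` and `y`) and soundness `1/3`
(all witnesses) on every input where `f` is defined. -/
def MerlinProtocol.Verifies {n m a w : ℕ} (P : MerlinProtocol n m a w)
    (f : PartialBoolFun n m) : Prop :=
  ∀ x y,
    (f x y = some true → ∃ φ : Bits w → ℂ, IsPureState φ ∧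
      2 / 3 ≤ acceptProb (P.measure y) (tensorState (P.message x) φ)) ∧
    (f x y = some false → ∀ φ : Bits w → ℂ, IsPureState φ →
      acceptProb (P.measure y) (tensorState (P.message x) φ) ≤ 1 / 3)

/-- The bounded-error one-way quantum communication complexity `Q¹(f)`. -/
noncomputable def Q1 {n m : ℕ} (f : PartialBoolFun n m) : ℕ :=
  sInf {a : ℕ | ∃ P : OneWayProtocol n m a, P.Computes f}

/-- `QMA¹_w(f)`: the least number of qubits Alice sends in a protocol verifying `f` in which
Merlin sends `w` qubits. -/
noncomputable def QMA1 {n m : ℕ} (w : ℕ) (f : PartialBoolFun n m) : ℕ :=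
  sInf {a : ℕ | ∃ P : MerlinProtocol n m a w, P.Verifies f}

/-! The minima above are over nonempty sets: Alice can send `x` itself as a basis state. -/

theorem isPureState_single {ι : Type*} [Fintype ι] [DecidableEq ι] (i : ι) :
    IsPureState (Pi.single i 1 : ι → ℂ) := by
  unfold IsPureState
  rw [Finset.sum_eq_single i]
  · simp
  · intro j _ hj
    simp [Pi.single_eq_of_ne hj]
  · simp

theorem isMeasurementOperator_diagonal {ι : Type*} [Fintype ι] [DecidableEq ι]
    (p : ι → Prop) [DecidablePred p] :
    IsMeasurementOperator (Matrix.diagonal fun i => if p i then (1 : ℂ) else 0) := by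
  constructor
  · refine Matrix.PosSemidef.diagonal fun i => ?_
    by_cases h : p i <;> simp [h]
  · rw [← Matrix.diagonal_one, Matrix.diagonal_sub]
    refine Matrix.PosSemidef.diagonal fun i => ?_
    by_cases h : p i <;> simp [h]

theorem acceptProb_diagonal {ι : Type*} [Fintype ι] [DecidableEq ι]
    (p : ι → Prop) [DecidablePred p] (ψ : ι → ℂ) :
    acceptProb (Matrix.diagonal fun i => if p i then (1 : ℂ) else 0) ψ =
      ∑ i, if p i then ‖ψ i‖ ^ 2 else 0 := by
  unfold acceptProb
  simp only [dotProduct, Matrix.mulVec_diagonal, Complex.re_sum]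
  refine Finset.sum_congr rfl fun i _ => ?_
  by_cases h : p i
  · simp only [h, if_true, one_mul, Pi.star_apply]
    rw [Complex.star_def, ← Complex.normSq_eq_conj_mul_self, Complex.normSq_eq_norm_sq,
      Complex.ofReal_re]
  · simp [h]

theorem Q1_nonempty {n m : ℕ} (f : PartialBoolFun n m) :
    {a : ℕ | ∃ P : OneWayProtocol n m a, P.Computes f}.Nonempty := by
  refine ⟨n, ⟨fun x => Pi.single x 1, fun x => isPureState_single x,
    fun y => Matrix.diagonal fun x => if f x y = some true then 1 else 0,
    fun y => isMeasurementOperator_diagonal _⟩, fun x y => ⟨fun h => ?_, fun h => ?_⟩⟩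
  · simp only [acceptProb_diagonal]
    rw [Finset.sum_eq_single x]
    · norm_num [h]
    · intro j _ hj
      simp [Pi.single_eq_of_ne hj]
    · simp
  · simp only [acceptProb_diagonal]
    rw [Finset.sum_eq_zero]
    · norm_num
    · intro j _
      by_cases hj : j = x
      · simp [hj, h]
      · simp [Pi.single_eq_of_ne hj]

theorem QMA1_nonempty {n m : ℕ} (w : ℕ) (f : PartialBoolFun n m) :
    {a : ℕ | ∃ P : MerlinProtocol n m a w, P.Verifies f}.Nonempty := by
  refine ⟨n, ⟨fun x => Pi.single x 1, fun x => isPureState_single x,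
    fun y => Matrix.diagonal fun q => if f q.1 y = some true then 1 else 0,
    fun y => isMeasurementOperator_diagonal _⟩, fun x y => ⟨fun h => ?_, fun h φ _ => ?_⟩⟩
  · refine ⟨Pi.single (fun _ => false) 1, isPureState_single _, ?_⟩
    simp only [acceptProb_diagonal]
    rw [Finset.sum_eq_single (x, fun _ => false)]
    · norm_num [h, tensorState]
    · rintro ⟨i, j⟩ _ hij
      by_cases hi : i = x
      · have hj : j ≠ fun _ => false := by
          rintro rfl
          exact hij (by rw [hi])
        simp [tensorState, Pi.single_eq_of_ne hj]
      · simp [tensorState, Pi.single_eq_of_ne hi]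
    · simp
  · simp only [acceptProb_diagonal]
    rw [Finset.sum_eq_zero]
    · norm_num
    · rintro ⟨i, j⟩ _
      by_cases hi : i = x
      · simp [hi, h]
      · simp [tensorState, Pi.single_eq_of_ne hi]

/-! Merlin is removed by replacing his witness with a maximally mixed one, which costs a factor of
the witness dimension `D` in the acceptance probability. So the soundness error must first be pushed
below about `1/D` without making the witness much longer. Parallel repetition alone fails, since it
lengthens the witness along with the message. Two amplifications are combined.
`exists_threshold_amplification` uses `2k` copies of message and witness and brings both errors to
`(8/9)^k`. With `k` of order `log w` the witness has `2kw` qubits and honest tests hardly disturb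
it. `exists_sequential_amplification` then reuses that one witness against `r` fresh messages:
soundness drops to `3^(-r)`, while gentle measurement keeps the completeness error at `1/12`. The
witness has stopped growing, so `r = 4kw` beats `D = 2^(2kw)`. Finally
`exists_measurement_without_witness` measures Alice's message alone. Let `X` be `E` summed over a
basis of witnesses. It is small on 0-inputs, but on 1-inputs it only dominates the form of the good
witness. The measurement `X(X + 1/12)⁻¹`, a smooth spectral cut-off, turns this domination into
constant acceptance. The message length is `a · 2k · r`, of order `a w log² w`. -/

open scoped Kronecker

/-! ### Acceptance probabilities as Hermitian quadratic forms -/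

section QuadraticForm

variable {ι κ : Type*} [Fintype ι] [Fintype κ]

theorem acceptProb_add (A B : Matrix ι ι ℂ) (v : ι → ℂ) :
    acceptProb (A + B) v = acceptProb A v + acceptProb B v := by
  simp [acceptProb, Matrix.add_mulVec, dotProduct_add]

theorem acceptProb_sub (A B : Matrix ι ι ℂ) (v : ι → ℂ) :
    acceptProb (A - B) v = acceptProb A v - acceptProb B v := by
  simp [acceptProb, Matrix.sub_mulVec, dotProduct_sub]

theorem acceptProb_smul (c : ℝ) (A : Matrix ι ι ℂ) (v : ι → ℂ) :
    acceptProb ((c : ℂ) • A) v = c * acceptProb A v := by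
  simp [acceptProb, Matrix.smul_mulVec, dotProduct_smul]

theorem acceptProb_sum {τ : Type*} (s : Finset τ) (A : τ → Matrix ι ι ℂ) (v : ι → ℂ) :
    acceptProb (∑ t ∈ s, A t) v = ∑ t ∈ s, acceptProb (A t) v := by
  simp [acceptProb, Matrix.sum_mulVec, dotProduct_sum]

theorem acceptProb_one [DecidableEq ι] (v : ι → ℂ) :
    acceptProb (1 : Matrix ι ι ℂ) v = ∑ i, ‖v i‖ ^ 2 := by
  have h := acceptProb_diagonal (fun _ : ι => True) v
  simpa using h

theorem IsPureState.acceptProb_one [DecidableEq ι] {v : ι → ℂ} (hv : IsPureState v) :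
    acceptProb (1 : Matrix ι ι ℂ) v = 1 :=
  (_root_.acceptProb_one v).trans hv

theorem acceptProb_nonneg {A : Matrix ι ι ℂ} (hA : A.PosSemidef) (v : ι → ℂ) :
    0 ≤ acceptProb A v :=
  (Complex.le_def.1 (hA.dotProduct_mulVec_nonneg v)).1

theorem acceptProb_le_of_posSemidef_sub {A B : Matrix ι ι ℂ} (h : (B - A).PosSemidef)
    (v : ι → ℂ) : acceptProb A v ≤ acceptProb B v := by
  have := acceptProb_nonneg h v
  rw [acceptProb_sub] at this
  linarith

theorem acceptProb_conjTranspose_mul_mul (A : Matrix ι ι ℂ) (V : Matrix ι κ ℂ) (v : κ → ℂ) :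
    acceptProb (Vᴴ * A * V) v = acceptProb A (V *ᵥ v) := by
  unfold acceptProb
  rw [← Matrix.mulVec_mulVec, ← Matrix.mulVec_mulVec, Matrix.dotProduct_mulVec _ Vᴴ,
    Matrix.star_mulVec]

theorem posSemidef_of_acceptProb_nonneg {A : Matrix ι ι ℂ} (hA : A.IsHermitian)
    (h : ∀ v, 0 ≤ acceptProb A v) : A.PosSemidef := by
  refine Matrix.PosSemidef.of_dotProduct_mulVec_nonneg hA fun v => Complex.le_def.2 ⟨h v, ?_⟩
  have := hA.im_star_dotProduct_mulVec_self v
  simpa using this.symm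

theorem acceptProb_smul_vec (A : Matrix ι ι ℂ) (c : ℝ) (v : ι → ℂ) :
    acceptProb A ((c : ℂ) • v) = c ^ 2 * acceptProb A v := by
  simp [acceptProb, Matrix.mulVec_smul, dotProduct_smul, smul_dotProduct]
  ring

theorem acceptProb_vec_sub {A : Matrix ι ι ℂ} (hA : A.IsHermitian) (u v : ι → ℂ) :
    acceptProb A (u - v) =
      acceptProb A u - 2 * (star u ⬝ᵥ (A *ᵥ v)).re + acceptProb A v := by
  have h : (star v ⬝ᵥ (A *ᵥ u)).re = (star u ⬝ᵥ (A *ᵥ v)).re := by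
    have : star (star u ⬝ᵥ (A *ᵥ v)) = star v ⬝ᵥ (A *ᵥ u) := by
      rw [Matrix.star_dotProduct, star_star, Matrix.star_mulVec, hA.eq,
        ← Matrix.dotProduct_mulVec]
    rw [← this]
    simp
  simp only [acceptProb, Matrix.mulVec_sub, star_sub, sub_dotProduct, dotProduct_sub,
    Complex.sub_re, h]
  ring

/-- Cauchy–Schwarz for a positive semidefinite form, combined with the inequality of arithmetic
and geometric means. -/
theorem two_mul_re_dotProduct_mulVec_le {A : Matrix ι ι ℂ} (hA : A.PosSemidef) {r : ℝ}
    (hr : 0 < r) (u v : ι → ℂ) :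
    2 * (star u ⬝ᵥ (A *ᵥ v)).re ≤ r * acceptProb A u + r⁻¹ * acceptProb A v := by
  have h := acceptProb_nonneg hA ((r : ℂ) • u - v)
  rw [acceptProb_vec_sub hA.isHermitian, acceptProb_smul_vec] at h
  have h2 : (star ((r : ℂ) • u) ⬝ᵥ (A *ᵥ v)).re = r * (star u ⬝ᵥ (A *ᵥ v)).re := by
    simp [smul_dotProduct]
  rw [h2] at h
  have : 2 * (star u ⬝ᵥ (A *ᵥ v)).re * r ≤ (r * acceptProb A u + r⁻¹ * acceptProb A v) * r := by
    field_simp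
    nlinarith
  exact le_of_mul_le_mul_right this hr

/-- By homogeneity; needed because states left after a test are not normalised. -/
theorem acceptProb_le_mul_of_pure {A : Matrix ι ι ℂ} {c : ℝ}
    (h : ∀ v, IsPureState v → acceptProb A v ≤ c) (v : ι → ℂ) :
    acceptProb A v ≤ c * ∑ i, ‖v i‖ ^ 2 := by
  set s := ∑ i, ‖v i‖ ^ 2 with hs
  have hs0 : 0 ≤ s := Finset.sum_nonneg fun i _ => by positivity
  rcases hs0.eq_or_lt with h0 | hpos
  · have hv : v = 0 := by
      funext i
      have := (Finset.sum_eq_zero_iff_of_nonneg (fun i _ => by positivity)).1 (hs ▸ h0.symm) i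
        (Finset.mem_univ i)
      simpa using this
    rw [← h0]
    simp [hv, acceptProb]
  · have hsq : (√s)⁻¹ ^ 2 = s⁻¹ := by rw [inv_pow, Real.sq_sqrt hs0]
    have hp : IsPureState ((((√s)⁻¹ : ℝ) : ℂ) • v) := by
      unfold IsPureState
      simp only [Pi.smul_apply, smul_eq_mul, norm_mul, mul_pow, Complex.norm_real,
        Real.norm_eq_abs, sq_abs, ← Finset.mul_sum, hsq, ← hs]
      exact inv_mul_cancel₀ hpos.ne'
    have := h _ hp
    rw [acceptProb_smul_vec, hsq] at this
    rwa [inv_mul_le_iff₀ hpos, mul_comm] at this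

/-- Turns soundness against every witness into an operator inequality. Such inequalities survive
tensor products, which is how entangled witnesses are handled. -/
theorem posSemidef_smul_one_sub [DecidableEq ι] {A : Matrix ι ι ℂ} (hA : A.IsHermitian) {c : ℝ}
    (h : ∀ v, IsPureState v → acceptProb A v ≤ c) :
    ((c : ℂ) • (1 : Matrix ι ι ℂ) - A).PosSemidef := by
  refine posSemidef_of_acceptProb_nonneg ?_ fun v => ?_
  · refine Matrix.IsHermitian.sub ?_ hA
    simp [Matrix.IsHermitian]
  · rw [acceptProb_sub, acceptProb_smul, acceptProb_one]
    linarith [acceptProb_le_mul_of_pure h v]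

theorem acceptProb_le_of_posSemidef_smul_one_sub [DecidableEq ι] {A : Matrix ι ι ℂ} {c : ℝ}
    (h : ((c : ℂ) • (1 : Matrix ι ι ℂ) - A).PosSemidef) {v : ι → ℂ} (hv : IsPureState v) :
    acceptProb A v ≤ c := by
  have := acceptProb_nonneg h v
  rw [acceptProb_sub, acceptProb_smul, hv.acceptProb_one] at this
  linarith

theorem acceptProb_submatrix (Γ : Matrix ι ι ℂ) (e : κ ≃ ι) (v : ι → ℂ) :
    acceptProb (Γ.submatrix e e) (v ∘ e) = acceptProb Γ v := by
  unfold acceptProb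
  rw [Matrix.submatrix_mulVec_equiv]
  simp only [Function.comp_assoc, Equiv.self_comp_symm, Function.comp_id]
  congr 1
  exact Fintype.sum_equiv e _ _ fun i => rfl

theorem IsPureState.comp_equiv {v : ι → ℂ} (hv : IsPureState v) (e : κ ≃ ι) :
    IsPureState (v ∘ e) := by
  unfold IsPureState at *
  rw [← hv]
  exact Fintype.sum_equiv e _ _ fun i => rfl

theorem IsPureState.tensorState {u : ι → ℂ} {v : κ → ℂ} (hu : IsPureState u)
    (hv : IsPureState v) : IsPureState (tensorState u v) := by
  unfold IsPureState at *
  simp only [_root_.tensorState, norm_mul, mul_pow, Fintype.sum_prod_type, ← Finset.mul_sum, hv,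
    mul_one, hu]

end QuadraticForm

/-! ### Operations preserving measurement operators -/

section Measurement

variable {ι κ : Type*} [Fintype ι] [Fintype κ] [DecidableEq ι] [DecidableEq κ]

theorem IsMeasurementOperator.compl {Γ : Matrix ι ι ℂ} (h : IsMeasurementOperator Γ) :
    IsMeasurementOperator (1 - Γ) :=
  ⟨h.2, by simpa using h.1⟩

theorem isMeasurementOperator_one : IsMeasurementOperator (1 : Matrix ι ι ℂ) :=
  ⟨.one, by simpa using Matrix.PosSemidef.zero⟩

theorem isMeasurementOperator_zero : IsMeasurementOperator (0 : Matrix ι ι ℂ) :=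
  ⟨.zero, by simpa using Matrix.PosSemidef.one⟩

/-- From `Γ - Γ² = Γ(1 - Γ)Γ + (1 - Γ)Γ(1 - Γ)`. -/
theorem IsMeasurementOperator.sub_sq_posSemidef {Γ : Matrix ι ι ℂ}
    (h : IsMeasurementOperator Γ) : (Γ - Γ * Γ).PosSemidef := by
  have h1 := h.2.conjTranspose_mul_mul_same Γ
  have h2 := h.1.conjTranspose_mul_mul_same (1 - Γ)
  rw [h.1.isHermitian.eq] at h1
  rw [h.2.isHermitian.eq] at h2
  convert h1.add h2 using 1
  noncomm_ring

theorem IsMeasurementOperator.submatrix {Γ : Matrix ι ι ℂ} (h : IsMeasurementOperator Γ)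
    (e : κ ≃ ι) : IsMeasurementOperator (Γ.submatrix e e) := by
  refine ⟨h.1.submatrix e, ?_⟩
  have := h.2.submatrix e
  rwa [Matrix.submatrix_sub, Pi.sub_apply, Pi.sub_apply, Matrix.submatrix_one_equiv] at this

theorem IsMeasurementOperator.conj {Γ E : Matrix ι ι ℂ} (hΓ : IsMeasurementOperator Γ)
    (hE : IsMeasurementOperator E) : IsMeasurementOperator (Γ * E * Γ) := by
  have h1 := hE.1.conjTranspose_mul_mul_same Γ
  have h2 := hE.2.conjTranspose_mul_mul_same Γ
  rw [hΓ.1.isHermitian.eq] at h1 h2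
  refine ⟨h1, ?_⟩
  -- `1 - ΓEΓ = Γ(1 - E)Γ + (Γ - Γ²) + (1 - Γ)`.
  convert (h2.add hΓ.sub_sq_posSemidef).add hΓ.2 using 1
  noncomm_ring

theorem IsMeasurementOperator.kronecker_add_compl_kronecker {Γ : Matrix ι ι ℂ}
    {E F : Matrix κ κ ℂ} (hΓ : IsMeasurementOperator Γ) (hE : IsMeasurementOperator E)
    (hF : IsMeasurementOperator F) : IsMeasurementOperator (Γ ⊗ₖ E + (1 - Γ) ⊗ₖ F) := by
  refine ⟨(hΓ.1.kronecker hE.1).add (hΓ.2.kronecker hF.1), ?_⟩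
  have h : 1 - (Γ ⊗ₖ E + (1 - Γ) ⊗ₖ F) = Γ ⊗ₖ (1 - E) + (1 - Γ) ⊗ₖ (1 - F) := by
    rw [← Matrix.one_kronecker_one]
    ext ⟨a, b⟩ ⟨a', b'⟩
    simp only [Matrix.sub_apply, Matrix.add_apply, Matrix.kroneckerMap_apply]
    ring
  rw [h]
  exact (hΓ.1.kronecker hE.2).add (hΓ.2.kronecker hF.2)

theorem IsMeasurementOperator.kronecker_one {Γ : Matrix ι ι ℂ} (hΓ : IsMeasurementOperator Γ) :
    IsMeasurementOperator (Γ ⊗ₖ (1 : Matrix κ κ ℂ)) := by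
  simpa using hΓ.kronecker_add_compl_kronecker
    (isMeasurementOperator_one (ι := κ)) isMeasurementOperator_zero

theorem IsMeasurementOperator.one_kronecker {Γ : Matrix ι ι ℂ} (hΓ : IsMeasurementOperator Γ) :
    IsMeasurementOperator ((1 : Matrix κ κ ℂ) ⊗ₖ Γ) := by
  simpa using (isMeasurementOperator_one (ι := κ)).kronecker_add_compl_kronecker hΓ hΓ

end Measurement

/-! ### Fixing Alice's message to get an operator on the witness -/

section Contraction

/-- The linear map `φ ↦ ψ ⊗ φ`. -/
def tensorLeft {α κ : Type*} [DecidableEq κ] (ψ : α → ℂ) : Matrix (α × κ) κ ℂ :=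
  Matrix.of fun p j => if p.2 = j then ψ p.1 else 0

/-- The operator on the second factor obtained from `Γ` by fixing the state `ψ` of the first. -/
def contract {α κ : Type*} [Fintype α] [Fintype κ] [DecidableEq κ]
    (Γ : Matrix (α × κ) (α × κ) ℂ) (ψ : α → ℂ) : Matrix κ κ ℂ :=
  (tensorLeft ψ : Matrix (α × κ) κ ℂ)ᴴ * Γ * (tensorLeft ψ : Matrix (α × κ) κ ℂ)

theorem tensorLeft_mulVec {α κ : Type*} [Fintype κ] [DecidableEq κ] (ψ : α → ℂ) (φ : κ → ℂ) :
    tensorLeft ψ *ᵥ φ = tensorState ψ φ := by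
  funext p
  simp [tensorLeft, Matrix.mulVec, dotProduct, tensorState]

variable {α β κ κ' : Type*} [Fintype α] [Fintype β] [Fintype κ] [Fintype κ']

theorem tensorState_dotProduct (u u' : α → ℂ) (v v' : β → ℂ) :
    tensorState u v ⬝ᵥ tensorState u' v' = (u ⬝ᵥ u') * (v ⬝ᵥ v') := by
  simp only [dotProduct, Fintype.sum_prod_type, tensorState, Finset.sum_mul_sum]
  exact Finset.sum_congr rfl fun a _ => Finset.sum_congr rfl fun b _ => by ring

theorem kronecker_mulVec_tensorState {γ δ : Type*} (A : Matrix γ α ℂ) (B : Matrix δ β ℂ)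
    (u : α → ℂ) (v : β → ℂ) :
    (A ⊗ₖ B) *ᵥ tensorState u v = tensorState (A *ᵥ u) (B *ᵥ v) := by
  funext p
  exact tensorState_dotProduct (A p.1) u (B p.2) v

theorem star_tensorState {γ δ : Type*} (u : γ → ℂ) (v : δ → ℂ) :
    star (tensorState u v) = tensorState (star u) (star v) := by
  funext p
  simp [tensorState]

theorem acceptProb_kronecker {A : Matrix α α ℂ} {B : Matrix β β ℂ} (hA : A.IsHermitian)
    (u : α → ℂ) (v : β → ℂ) :
    acceptProb (A ⊗ₖ B) (tensorState u v) = acceptProb A u * acceptProb B v := by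
  have him := hA.im_star_dotProduct_mulVec_self u
  simp only [RCLike.im_to_complex] at him
  rw [acceptProb, kronecker_mulVec_tensorState, star_tensorState, tensorState_dotProduct,
    Complex.mul_re, him, acceptProb, acceptProb]
  ring

variable [DecidableEq κ] [DecidableEq κ']

theorem acceptProb_contract (Γ : Matrix (α × κ) (α × κ) ℂ) (ψ : α → ℂ) (φ : κ → ℂ) :
    acceptProb (contract Γ ψ) φ = acceptProb Γ (tensorState ψ φ) := by
  rw [contract, acceptProb_conjTranspose_mul_mul, tensorLeft_mulVec]

theorem contract_posSemidef {Γ : Matrix (α × κ) (α × κ) ℂ} (hΓ : Γ.PosSemidef) (ψ : α → ℂ) :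
    (contract Γ ψ).PosSemidef :=
  hΓ.conjTranspose_mul_mul_same _

theorem contract_add (Γ Δ : Matrix (α × κ) (α × κ) ℂ) (ψ : α → ℂ) :
    contract (Γ + Δ) ψ = contract Γ ψ + contract Δ ψ := by
  simp [contract, Matrix.mul_add, Matrix.add_mul]

theorem contract_sub (Γ Δ : Matrix (α × κ) (α × κ) ℂ) (ψ : α → ℂ) :
    contract (Γ - Δ) ψ = contract Γ ψ - contract Δ ψ := by
  simp [contract, Matrix.mul_sub, Matrix.sub_mul]

theorem contract_one [DecidableEq α] {ψ : α → ℂ} (hψ : IsPureState ψ) :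
    contract (1 : Matrix (α × κ) (α × κ) ℂ) ψ = 1 := by
  have h : ∑ a, (starRingEnd ℂ) (ψ a) * ψ a = 1 := by
    simp_rw [← Complex.normSq_eq_conj_mul_self, Complex.normSq_eq_norm_sq]
    exact_mod_cast hψ
  ext i j
  simp only [contract, Matrix.mul_one, Matrix.mul_apply, Matrix.conjTranspose_apply, tensorLeft,
    Matrix.of_apply, Fintype.sum_prod_type]
  by_cases hij : i = j
  · subst hij
    simp [h]
  · rw [Matrix.one_apply_ne hij]
    refine Finset.sum_eq_zero fun a _ => Finset.sum_eq_zero fun k _ => ?_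
    by_cases hk : k = i
    · subst hk
      simp [hij]
    · simp [hk]

/-- Alice's copies are in a product state, so the operator left on the witness registers factors,
whatever entanglement Merlin uses between them. -/
theorem contract_kronecker (Γ : Matrix (α × κ) (α × κ) ℂ) (E : Matrix (β × κ') (β × κ') ℂ)
    (ψ : α → ℂ) (χ : β → ℂ) :
    contract ((Γ ⊗ₖ E).submatrix (Equiv.prodProdProdComm α β κ κ')
      (Equiv.prodProdProdComm α β κ κ')) (tensorState ψ χ) = contract Γ ψ ⊗ₖ contract E χ := by
  have h : (tensorLeft (tensorState ψ χ) : Matrix ((α × β) × (κ × κ')) (κ × κ') ℂ) =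
      (tensorLeft ψ ⊗ₖ tensorLeft χ).submatrix (Equiv.prodProdProdComm α β κ κ') id := by
    ext ⟨⟨a, b⟩, k, l⟩ ⟨k', l'⟩
    simp only [tensorLeft, tensorState, Matrix.of_apply, Matrix.submatrix_apply,
      Equiv.prodProdProdComm_apply, Matrix.kroneckerMap_apply, id, Prod.mk.injEq]
    by_cases h1 : k = k' <;> by_cases h2 : l = l' <;> simp [h1, h2]
  rw [contract, h, Matrix.conjTranspose_submatrix, Matrix.submatrix_mul_equiv,
    Matrix.submatrix_mul_equiv, Matrix.conjTranspose_kronecker, Matrix.submatrix_id_id,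
    ← Matrix.mul_kronecker_mul, ← Matrix.mul_kronecker_mul, contract, contract]

end Contraction

/-! ### Parallel repetition with a threshold -/

section Threshold

/-- Parallel repetition: Alice's message and the witness are both repeated `l` times, and `E k` is
the measurement that accepts when at least `k` of the `l` independent tests accept. -/
theorem exists_threshold_amplification (α κ : Type) [Fintype α] [DecidableEq α] [Fintype κ]
    [DecidableEq κ] (l : ℕ) :
    ∃ (β κ' : Type) (_ : Fintype β) (_ : DecidableEq β) (_ : Fintype κ') (_ : DecidableEq κ')
      (T : (α → ℂ) → (β → ℂ)), Fintype.card β = Fintype.card α ^ l ∧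
      Fintype.card κ' = Fintype.card κ ^ l ∧ (∀ ψ, IsPureState ψ → IsPureState (T ψ)) ∧
      ∀ Γ : Matrix (α × κ) (α × κ) ℂ, IsMeasurementOperator Γ →
        ∃ E : ℕ → Matrix (β × κ') (β × κ') ℂ, (∀ k, IsMeasurementOperator (E k)) ∧
          ∀ ψ, IsPureState ψ →
            ((∀ φ, IsPureState φ → acceptProb Γ (tensorState ψ φ) ≤ 1 / 3) → ∀ k Φ,
              IsPureState Φ →
                acceptProb (E k) (tensorState (T ψ) Φ) ≤ (2 ^ k)⁻¹ * (4 / 3) ^ l) ∧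
            (∀ φ, IsPureState φ → 2 / 3 ≤ acceptProb Γ (tensorState ψ φ) →
              ∃ Φ, IsPureState Φ ∧ ∀ k,
                1 - acceptProb (E k) (tensorState (T ψ) Φ) ≤ 2 ^ k * (2 / 3) ^ l) := by
  induction l with
  | zero =>
    refine ⟨Unit, Unit, inferInstance, inferInstance, inferInstance, inferInstance,
      fun _ _ => 1, by simp, by simp, fun _ _ => by simp [IsPureState], fun Γ _ =>
      ⟨fun k => if k = 0 then 1 else 0, fun k => ?_, fun ψ _ => ⟨fun _ k Φ hΦ => ?_, fun φ _ _ =>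
        ⟨fun _ => 1, by simp [IsPureState], fun k => ?_⟩⟩⟩⟩
    · dsimp only
      split_ifs
      exacts [isMeasurementOperator_one, isMeasurementOperator_zero]
    · have hp : IsPureState (tensorState (fun _ : Unit => (1 : ℂ)) Φ) :=
        IsPureState.tensorState (by simp [IsPureState]) hΦ
      dsimp only
      split_ifs with hk
      · simp [hk, hp.acceptProb_one]
      · simp [acceptProb]
    · have hp : IsPureState (tensorState (fun _ : Unit => (1 : ℂ)) (fun _ : Unit => (1 : ℂ))) :=
        IsPureState.tensorState (by simp [IsPureState]) (by simp [IsPureState])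
      dsimp only
      split_ifs with hk
      · simp [hk, hp.acceptProb_one]
      · simpa [acceptProb] using one_le_pow₀ (one_le_two (α := ℝ))
  | succ l ih =>
    obtain ⟨β, κ', _, _, _, _, T, hβ, hκ', hT, hE⟩ := ih
    refine ⟨α × β, κ × κ', inferInstance, inferInstance, inferInstance, inferInstance,
      fun ψ => tensorState ψ (T ψ), by rw [Fintype.card_prod, hβ, pow_succ'],
      by rw [Fintype.card_prod, hκ', pow_succ'], fun ψ hψ => hψ.tensorState (hT ψ hψ),
      fun Γ hΓ => ?_⟩
    obtain ⟨E, hEm, hEψ⟩ := hE Γ hΓ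
    -- If the new test accepts, one acceptance fewer is required of the others. Threshold 0 always
    -- accepts.
    refine ⟨fun k => match k with
      | 0 => 1
      | k + 1 => (Γ ⊗ₖ E k + (1 - Γ) ⊗ₖ E (k + 1)).submatrix
          (Equiv.prodProdProdComm α β κ κ') (Equiv.prodProdProdComm α β κ κ'), ?_, ?_⟩
    · rintro (_ | k)
      · exact isMeasurementOperator_one
      · exact (hΓ.kronecker_add_compl_kronecker (hEm k) (hEm (k + 1))).submatrix _
    · intro ψ hψ
      obtain ⟨hs, hc⟩ := hEψ ψ hψ
      have hΓψ := contract_posSemidef hΓ.1 ψ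
      have hΓψ' : (1 - contract Γ ψ).PosSemidef := by
        rw [← contract_one hψ, ← contract_sub]
        exact contract_posSemidef hΓ.2 ψ
      have hstep : ∀ k, contract ((Γ ⊗ₖ E k + (1 - Γ) ⊗ₖ E (k + 1)).submatrix
          (Equiv.prodProdProdComm α β κ κ') (Equiv.prodProdProdComm α β κ κ'))
          (tensorState ψ (T ψ)) = contract Γ ψ ⊗ₖ contract (E k) (T ψ) +
            (1 - contract Γ ψ) ⊗ₖ contract (E (k + 1)) (T ψ) := by
        intro k
        rw [Matrix.submatrix_add, Pi.add_apply, Pi.add_apply, contract_add, contract_kronecker,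
          contract_kronecker, contract_sub, contract_one hψ]
      refine ⟨fun h => ?_, fun φ hφ h => ?_⟩
      · rintro (_ | k) Φ hΦ
        · dsimp only
          rw [((hψ.tensorState (hT ψ hψ)).tensorState hΦ).acceptProb_one]
          simpa using one_le_pow₀ (by norm_num : (1 : ℝ) ≤ 4 / 3)
        · dsimp only
          rw [← acceptProb_contract, hstep]
          have h1 := posSemidef_smul_one_sub hΓψ.isHermitian
            (c := 1 / 3) fun φ hφ => by rw [acceptProb_contract]; exact h φ hφ
          have h2 := fun k => posSemidef_smul_one_sub
            (contract_posSemidef (hEm k).1 (T ψ)).isHermitian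
            fun φ hφ => by rw [acceptProb_contract]; exact hs h k φ hφ
          refine acceptProb_le_of_posSemidef_smul_one_sub ?_ hΦ
          have hB : (0 : ℝ) ≤ (2 ^ (k + 1))⁻¹ * (4 / 3) ^ l := by positivity
          have h3 := ((hΓψ.kronecker (h2 k)).add (hΓψ'.kronecker (h2 (k + 1)))).add
            ((h1.kronecker (.one (n := κ'))).smul (Complex.zero_le_real.2 hB))
          -- The Chernoff bound for `2^count` at operator level. With `M = contract Γ ψ ≤ 1/3` and
          -- `B k = 2^(-k) (4/3)^l = 2 B (k+1)`, one has `M B k + (1 - M) B (k+1) = (1 + M) B (k+1)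
          -- ≤ (4/3) B (k+1)`.
          have heq : ((((2 ^ (k + 1))⁻¹ * (4 / 3) ^ (l + 1) : ℝ) : ℂ) •
              (1 : Matrix (κ × κ') (κ × κ') ℂ) - (contract Γ ψ ⊗ₖ contract (E k) (T ψ) +
                (1 - contract Γ ψ) ⊗ₖ contract (E (k + 1)) (T ψ))) =
              contract Γ ψ ⊗ₖ ((((2 ^ k)⁻¹ * (4 / 3) ^ l : ℝ) : ℂ) • 1 - contract (E k) (T ψ)) +
              (1 - contract Γ ψ) ⊗ₖ
                ((((2 ^ (k + 1))⁻¹ * (4 / 3) ^ l : ℝ) : ℂ) • 1 - contract (E (k + 1)) (T ψ)) +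
              (((2 ^ (k + 1))⁻¹ * (4 / 3) ^ l : ℝ) : ℂ) •
                ((((1 / 3 : ℝ) : ℂ) • 1 - contract Γ ψ) ⊗ₖ (1 : Matrix κ' κ' ℂ)) := by
            rw [← Matrix.one_kronecker_one]
            ext ⟨a, b⟩ ⟨a', b'⟩
            simp only [Matrix.sub_apply, Matrix.add_apply, Matrix.kroneckerMap_apply,
              Matrix.smul_apply, smul_eq_mul]
            push_cast
            rw [pow_succ, pow_succ, mul_inv]
            ring
          rw [heq]
          exact h3
      · obtain ⟨Φ, hΦ, hk⟩ := hc φ hφ h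
        refine ⟨tensorState φ Φ, hφ.tensorState hΦ, ?_⟩
        rintro (_ | k)
        · dsimp only
          rw [((hψ.tensorState (hT ψ hψ)).tensorState (hφ.tensorState hΦ)).acceptProb_one]
          simp only [sub_self]
          positivity
        · dsimp only
          rw [← acceptProb_contract, hstep, acceptProb_add,
            acceptProb_kronecker hΓψ.isHermitian, acceptProb_kronecker hΓψ'.isHermitian,
            acceptProb_sub, hφ.acceptProb_one, acceptProb_contract, acceptProb_contract,
            acceptProb_contract]
          have hp1 : acceptProb Γ (tensorState ψ φ) ≤ 1 := by
            rw [← (hψ.tensorState hφ).acceptProb_one]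
            exact acceptProb_le_of_posSemidef_sub hΓ.2 _
          set p := acceptProb Γ (tensorState ψ φ)
          -- The dual bound, for `2^(-count)`: `p 2^k + (1 - p) 2^(k+1) = 2^(k+1) (1 - p/2)`, and `1
          -- - p/2 ≤ 2/3` since `p ≥ 2/3`.
          have hk1 := mul_le_mul_of_nonneg_left (hk k) (by linarith : (0 : ℝ) ≤ p)
          have hk2 := mul_le_mul_of_nonneg_left (hk (k + 1)) (by linarith : (0 : ℝ) ≤ 1 - p)
          have hpos : (0 : ℝ) ≤ 2 ^ k * (2 / 3) ^ l := by positivity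
          have := mul_le_mul_of_nonneg_right h hpos
          rw [pow_succ] at *
          rw [pow_succ (2 / 3 : ℝ) l]
          nlinarith

end Threshold

/-! ### Sequential repetition on a reused witness -/

section Sequential

/-- Moves the middle register to the end. -/
def middleToEnd (α β κ : Type*) : (α × β) × κ ≃ (α × κ) × β where
  toFun p := ((p.1.1, p.2), p.1.2)
  invFun p := ((p.1.1, p.2), p.1.2)
  left_inv _ := rfl
  right_inv _ := rfl

theorem tensorState_tensorState_eq_comp {α β κ : Type*} (ψ : α → ℂ) (χ : β → ℂ) (φ : κ → ℂ) :
    tensorState (tensorState ψ χ) φ = tensorState (tensorState ψ φ) χ ∘ middleToEnd α β κ := by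
  funext p
  simp [tensorState, middleToEnd, mul_right_comm]

/-- A test ignoring Alice's first register sees a mixture over its basis states, each branch
offering an unnormalised pure witness next to the fresh `χ`. -/
theorem acceptProb_one_kronecker_submatrix {α β κ : Type*} [Fintype α] [Fintype β] [Fintype κ]
    [DecidableEq α] (E : Matrix (β × κ) (β × κ) ℂ) (u : α × κ → ℂ) (χ : β → ℂ) :
    acceptProb (((1 : Matrix α α ℂ) ⊗ₖ E).submatrix (Equiv.prodAssoc α β κ)
        (Equiv.prodAssoc α β κ)) (tensorState u χ ∘ middleToEnd α β κ) =
      ∑ a, acceptProb E (tensorState χ fun k => u (a, k)) := by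
  have h : tensorState u χ ∘ middleToEnd α β κ =
      (fun q : α × β × κ => χ q.2.1 * u (q.1, q.2.2)) ∘ Equiv.prodAssoc α β κ := by
    funext p
    simp [tensorState, middleToEnd, mul_comm]
  rw [h, acceptProb_submatrix]
  simp only [acceptProb, dotProduct, Complex.re_sum, Fintype.sum_prod_type (α₁ := α)]
  refine Finset.sum_congr rfl fun a _ => Finset.sum_congr rfl fun q _ => ?_
  congr 2
  simp only [Matrix.mulVec, dotProduct, Fintype.sum_prod_type (α₁ := α),
    Matrix.kroneckerMap_apply]
  rw [Finset.sum_eq_single a]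
  · simp [tensorState]
  · intro b _ hb
    simp [Matrix.one_apply_ne hb.symm]
  · simp

theorem kronecker_one_submatrix_mulVec {α β κ : Type*} [Fintype α] [Fintype β] [Fintype κ]
    [DecidableEq β] (Γ : Matrix (α × κ) (α × κ) ℂ) (u : α × κ → ℂ) (χ : β → ℂ) :
    (Γ ⊗ₖ (1 : Matrix β β ℂ)).submatrix (middleToEnd α β κ) (middleToEnd α β κ) *ᵥ
      (tensorState u χ ∘ middleToEnd α β κ) = tensorState (Γ *ᵥ u) χ ∘ middleToEnd α β κ := by
  rw [Matrix.submatrix_mulVec_equiv, Function.comp_assoc, Equiv.self_comp_symm,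
    Function.comp_id, kronecker_mulVec_tensorState, Matrix.one_mulVec]

variable {α β κ : Type*} [Fintype α] [Fintype β] [Fintype κ] [DecidableEq α] [DecidableEq β]

/-- First the test `Γ` on the first and last register, then the test `E` on the last two. -/
def sequentialTest (Γ : Matrix (α × κ) (α × κ) ℂ) (E : Matrix (β × κ) (β × κ) ℂ) :
    Matrix ((α × β) × κ) ((α × β) × κ) ℂ :=
  (Γ ⊗ₖ (1 : Matrix β β ℂ)).submatrix (middleToEnd α β κ) (middleToEnd α β κ) *
    ((1 : Matrix α α ℂ) ⊗ₖ E).submatrix (Equiv.prodAssoc α β κ) (Equiv.prodAssoc α β κ) *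
    (Γ ⊗ₖ (1 : Matrix β β ℂ)).submatrix (middleToEnd α β κ) (middleToEnd α β κ)

theorem acceptProb_sequentialTest {Γ : Matrix (α × κ) (α × κ) ℂ} (hΓ : Γ.IsHermitian)
    (E : Matrix (β × κ) (β × κ) ℂ) (ψ : α → ℂ) (χ : β → ℂ) (φ : κ → ℂ) :
    acceptProb (sequentialTest Γ E) (tensorState (tensorState ψ χ) φ) =
      ∑ a, acceptProb E (tensorState χ fun k => (Γ *ᵥ tensorState ψ φ) (a, k)) := by
  have hG : ((Γ ⊗ₖ (1 : Matrix β β ℂ)).submatrix (middleToEnd α β κ)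
      (middleToEnd α β κ)).IsHermitian := by
    rw [Matrix.IsHermitian, Matrix.conjTranspose_submatrix, Matrix.conjTranspose_kronecker, hΓ.eq,
      Matrix.conjTranspose_one]
  rw [← acceptProb_one_kronecker_submatrix, ← kronecker_one_submatrix_mulVec,
    ← acceptProb_conjTranspose_mul_mul, hG.eq, tensorState_tensorState_eq_comp, sequentialTest]

variable [DecidableEq κ]

theorem IsMeasurementOperator.sequentialTest {Γ : Matrix (α × κ) (α × κ) ℂ}
    {E : Matrix (β × κ) (β × κ) ℂ} (hΓ : IsMeasurementOperator Γ)
    (hE : IsMeasurementOperator E) : IsMeasurementOperator (sequentialTest Γ E) :=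
  (hΓ.kronecker_one.submatrix _).conj (hE.one_kronecker.submatrix _)

theorem IsMeasurementOperator.sum_norm_sq_mulVec_le {ι : Type*} [Fintype ι] [DecidableEq ι]
    {Γ : Matrix ι ι ℂ} (h : IsMeasurementOperator Γ) (v : ι → ℂ) :
    ∑ i, ‖(Γ *ᵥ v) i‖ ^ 2 ≤ acceptProb Γ v := by
  rw [← acceptProb_one, ← acceptProb_conjTranspose_mul_mul, Matrix.mul_one, h.1.isHermitian.eq]
  exact acceptProb_le_of_posSemidef_sub h.sub_sq_posSemidef v

/-- Errors multiply although the witness is reused: soundness of `E` covers every witness, hence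
each branch left by the first test, and the branches have total weight `‖Γ(ψ ⊗ φ)‖² ≤ c`. -/
theorem acceptProb_sequentialTest_le {Γ : Matrix (α × κ) (α × κ) ℂ}
    (hΓ : IsMeasurementOperator Γ) {E : Matrix (β × κ) (β × κ) ℂ} {ψ : α → ℂ} {χ : β → ℂ}
    {c d : ℝ} (hd : 0 ≤ d) (hc : ∀ φ, IsPureState φ → acceptProb Γ (tensorState ψ φ) ≤ c)
    (hE : ∀ φ, IsPureState φ → acceptProb E (tensorState χ φ) ≤ d) {φ : κ → ℂ}
    (hφ : IsPureState φ) :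
    acceptProb (sequentialTest Γ E) (tensorState (tensorState ψ χ) φ) ≤ c * d := by
  rw [acceptProb_sequentialTest hΓ.1.isHermitian]
  calc ∑ a, acceptProb E (tensorState χ fun k => (Γ *ᵥ tensorState ψ φ) (a, k))
      ≤ ∑ a, d * ∑ k, ‖(Γ *ᵥ tensorState ψ φ) (a, k)‖ ^ 2 := by
        refine Finset.sum_le_sum fun a _ => ?_
        rw [← acceptProb_contract]
        exact acceptProb_le_mul_of_pure
          (fun φ hφ => by rw [acceptProb_contract]; exact hE φ hφ) _
    _ = d * ∑ p, ‖(Γ *ᵥ tensorState ψ φ) p‖ ^ 2 := by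
        rw [← Finset.mul_sum, Fintype.sum_prod_type]
    _ ≤ d * c := mul_le_mul_of_nonneg_left
        ((hΓ.sum_norm_sq_mulVec_le _).trans (hc φ hφ)) hd
    _ = c * d := mul_comm _ _

/-- Gentle measurement: a test that accepts `v` with probability `1 - b²` lowers the acceptance
probability of a later test by at most `2b`. -/
theorem IsMeasurementOperator.acceptProb_mulVec_ge {ι : Type*} [Fintype ι] [DecidableEq ι]
    {G F : Matrix ι ι ℂ} (hG : IsMeasurementOperator G) (hF : IsMeasurementOperator F)
    {v : ι → ℂ} (hv : IsPureState v) {b : ℝ} (hb : 0 < b) (h : 1 - acceptProb G v ≤ b ^ 2) :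
    acceptProb F v - 2 * b ≤ acceptProb F (G *ᵥ v) := by
  have hd : G *ᵥ v = v - (1 - G) *ᵥ v := by
    rw [Matrix.sub_mulVec, Matrix.one_mulVec, sub_sub_cancel]
  have hle : ∀ u, acceptProb F u ≤ ∑ i, ‖u i‖ ^ 2 := fun u => by
    rw [← acceptProb_one]
    exact acceptProb_le_of_posSemidef_sub hF.2 u
  have hF1 : acceptProb F v ≤ 1 := (hle v).trans hv.le
  have hFd : acceptProb F ((1 - G) *ᵥ v) ≤ b ^ 2 := by
    refine (hle _).trans ((hG.compl.sum_norm_sq_mulVec_le v).trans ?_)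
    rwa [acceptProb_sub, hv.acceptProb_one]
  -- Weight `b` balances the two terms: each is at most `b`.
  have hcs := two_mul_re_dotProduct_mulVec_le hF.1 hb v ((1 - G) *ᵥ v)
  rw [hd, acceptProb_vec_sub hF.1.isHermitian]
  have h0 := acceptProb_nonneg hF.1 ((1 - G) *ᵥ v)
  have h1 : b * acceptProb F v ≤ b := by nlinarith
  have h2 : b⁻¹ * acceptProb F ((1 - G) *ᵥ v) ≤ b := by
    rw [inv_mul_le_iff₀ hb]
    nlinarith
  linarith

theorem acceptProb_sequentialTest_ge {Γ : Matrix (α × κ) (α × κ) ℂ}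
    (hΓ : IsMeasurementOperator Γ) {E : Matrix (β × κ) (β × κ) ℂ}
    (hE : IsMeasurementOperator E) {ψ : α → ℂ} {χ : β → ℂ} {φ : κ → ℂ} (hψ : IsPureState ψ)
    (hχ : IsPureState χ) (hφ : IsPureState φ) {b : ℝ} (hb : 0 < b)
    (h : 1 - acceptProb Γ (tensorState ψ φ) ≤ b ^ 2) :
    acceptProb E (tensorState χ φ) - 2 * b ≤
      acceptProb (sequentialTest Γ E) (tensorState (tensorState ψ χ) φ) := by
  have hG := (hΓ.kronecker_one (κ := β)).submatrix (middleToEnd α β κ)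
  have hF := (hE.one_kronecker (κ := α)).submatrix (Equiv.prodAssoc α β κ)
  have hv : IsPureState (tensorState (tensorState ψ φ) χ ∘ middleToEnd α β κ) :=
    ((hψ.tensorState hφ).tensorState hχ).comp_equiv _
  have key := hG.acceptProb_mulVec_ge hF hv hb (by
    rw [acceptProb_submatrix, acceptProb_kronecker hΓ.1.isHermitian, hχ.acceptProb_one, mul_one]
    exact h)
  have hFv : acceptProb (((1 : Matrix α α ℂ) ⊗ₖ E).submatrix (Equiv.prodAssoc α β κ)
      (Equiv.prodAssoc α β κ)) (tensorState (tensorState ψ φ) χ ∘ middleToEnd α β κ) =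
      acceptProb E (tensorState χ φ) := by
    have : tensorState (tensorState ψ φ) χ ∘ middleToEnd α β κ =
        tensorState ψ (tensorState χ φ) ∘ Equiv.prodAssoc α β κ := by
      funext p
      simp [tensorState, middleToEnd, mul_comm, mul_left_comm]
    rw [this, acceptProb_submatrix, acceptProb_kronecker Matrix.isHermitian_one,
      hψ.acceptProb_one, one_mul]
  rw [hFv, ← acceptProb_conjTranspose_mul_mul, hG.1.isHermitian.eq] at key
  rwa [tensorState_tensorState_eq_comp]

/-- Sequential repetition: the same witness is tested `r` times, each time with a fresh copy of
Alice's message. -/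
theorem exists_sequential_amplification (α κ : Type) [Fintype α] [DecidableEq α] [Fintype κ]
    [DecidableEq κ] (r : ℕ) :
    ∃ (β : Type) (_ : Fintype β) (_ : DecidableEq β) (T : (α → ℂ) → (β → ℂ)),
      Fintype.card β = Fintype.card α ^ r ∧ (∀ ψ, IsPureState ψ → IsPureState (T ψ)) ∧
      ∀ Γ : Matrix (α × κ) (α × κ) ℂ, IsMeasurementOperator Γ →
        ∃ E : Matrix (β × κ) (β × κ) ℂ, IsMeasurementOperator E ∧
          ∀ ψ, IsPureState ψ →
            ((∀ φ, IsPureState φ → acceptProb Γ (tensorState ψ φ) ≤ 1 / 3) → ∀ φ,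
              IsPureState φ → acceptProb E (tensorState (T ψ) φ) ≤ (1 / 3) ^ r) ∧
            (∀ b : ℝ, 0 < b → ∀ φ, IsPureState φ →
              1 - acceptProb Γ (tensorState ψ φ) ≤ b ^ 2 →
                1 - acceptProb E (tensorState (T ψ) φ) ≤ 2 * b * r) := by
  induction r with
  | zero =>
    have h1 : IsPureState (fun _ : Unit => (1 : ℂ)) := by simp [IsPureState]
    refine ⟨Unit, inferInstance, inferInstance, fun _ _ => 1, by simp, fun _ _ => h1,
      fun Γ _ => ⟨1, isMeasurementOperator_one, fun ψ _ => ⟨fun _ φ hφ => ?_,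
        fun b _ φ hφ _ => ?_⟩⟩⟩
    · simp [(h1.tensorState hφ).acceptProb_one]
    · simp [(h1.tensorState hφ).acceptProb_one]
  | succ r ih =>
    obtain ⟨β, _, _, T, hβ, hT, hE⟩ := ih
    refine ⟨α × β, inferInstance, inferInstance, fun ψ => tensorState ψ (T ψ),
      by rw [Fintype.card_prod, hβ, pow_succ'], fun ψ hψ => hψ.tensorState (hT ψ hψ),
      fun Γ hΓ => ?_⟩
    obtain ⟨E, hEm, hEψ⟩ := hE Γ hΓ
    refine ⟨sequentialTest Γ E, hΓ.sequentialTest hEm, fun ψ hψ => ⟨fun h φ hφ => ?_,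
      fun b hb φ hφ h => ?_⟩⟩
    · rw [pow_succ']
      exact acceptProb_sequentialTest_le hΓ (by positivity) h ((hEψ ψ hψ).1 h) hφ
    · have h1 := (hEψ ψ hψ).2 b hb φ hφ h
      have h2 := acceptProb_sequentialTest_ge hΓ hEm hψ (hT ψ hψ) hφ hb h
      push_cast
      linarith

end Sequential

/-! ### Replacing the witness by a spectral test on Alice's message -/

section RemoveWitness

/-- The right side is the trace of `M`; compressing `M` by `1 - |φ⟩⟨φ|` leaves a nonnegative trace.
-/
theorem acceptProb_le_sum_single {κ : Type*} [Fintype κ] [DecidableEq κ] {M : Matrix κ κ ℂ}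
    (hM : M.PosSemidef) {φ : κ → ℂ} (hφ : IsPureState φ) :
    acceptProb M φ ≤ ∑ i, acceptProb M (Pi.single i 1) := by
  have hsq : star φ ⬝ᵥ φ = 1 := by
    have h : ∀ i, star (φ i) * φ i = ((‖φ i‖ ^ 2 : ℝ) : ℂ) := fun i => by
      rw [Complex.star_def, ← Complex.normSq_eq_conj_mul_self, Complex.normSq_eq_norm_sq]
    simp only [dotProduct, Pi.star_apply, h]
    exact_mod_cast hφ
  set P := Matrix.vecMulVec φ (star φ) with hP
  have hPh : Pᴴ = P := by simp [hP, Matrix.conjTranspose_vecMulVec]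
  have hPP : P * P = P := by
    rw [hP, Matrix.vecMulVec_mul_vecMulVec, hsq]
    simp
  have hQQ : (1 - P) * (1 - P) = 1 - P := by
    rw [mul_sub, sub_mul, sub_mul, hPP]
    simp
  have h0 := (hM.conjTranspose_mul_mul_same (1 - P)).trace_nonneg
  rw [Matrix.conjTranspose_sub, hPh, Matrix.conjTranspose_one, Matrix.trace_mul_cycle, hQQ,
    sub_mul, one_mul, Matrix.trace_sub, hP, Matrix.vecMulVec_mul, Matrix.trace_vecMulVec,
    dotProduct_comm, ← Matrix.dotProduct_mulVec] at h0
  have h1 := (Complex.le_def.1 h0).1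
  have h2 : ∀ i, acceptProb M (Pi.single i 1) = (M i i).re := fun i => by
    have : star (Pi.single i (1 : ℂ) : κ → ℂ) = Pi.single i 1 := by simp
    simp [acceptProb, this]
  simp only [Complex.sub_re, Complex.zero_re, Matrix.trace, Matrix.diag, Complex.re_sum] at h1
  simp only [h2]
  rw [acceptProb]
  linarith

/-- The resolvent `N = c (X + c)⁻¹` of a positive semidefinite matrix, described by the vectors
`z = N v`. -/
theorem exists_resolvent {ι : Type*} [Fintype ι] [DecidableEq ι] {X : Matrix ι ι ℂ}
    (hX : X.PosSemidef) {c : ℝ} (hc : 0 < c) :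
    ∃ N : Matrix ι ι ℂ, N.PosSemidef ∧ ∀ v, ∃ z, X *ᵥ z + (c : ℂ) • z = (c : ℂ) • v ∧
      (star z ⬝ᵥ v).re = acceptProb N v := by
  have hc' : (0 : ℂ) < c := by exact_mod_cast hc
  have hY : (X + (c : ℂ) • (1 : Matrix ι ι ℂ)).PosDef :=
    Matrix.PosDef.posSemidef_add hX (Matrix.PosDef.one.smul hc')
  have hN : ((c : ℂ) • (X + (c : ℂ) • (1 : Matrix ι ι ℂ))⁻¹).PosSemidef :=
    hY.posSemidef.inv.smul hc'.le
  refine ⟨_, hN, fun v => ⟨((c : ℂ) • (X + (c : ℂ) • (1 : Matrix ι ι ℂ))⁻¹) *ᵥ v, ?_, ?_⟩⟩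
  · have h : ∀ z, X *ᵥ z + (c : ℂ) • z = (X + (c : ℂ) • (1 : Matrix ι ι ℂ)) *ᵥ z := fun z => by
      rw [Matrix.add_mulVec, Matrix.smul_mulVec, Matrix.one_mulVec]
    rw [h, Matrix.mulVec_mulVec, Matrix.mul_smul,
      Matrix.mul_nonsing_inv _ ((Matrix.isUnit_iff_isUnit_det _).1 hY.isUnit),
      Matrix.smul_mulVec, Matrix.one_mulVec]
  · rw [Matrix.star_mulVec, hN.isHermitian.eq, ← Matrix.dotProduct_mulVec, acceptProb]

/-- A measurement without witness that accepts with probability at least `2/3` if some witness is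
accepted with probability at least `11/12`, and rejects if every witness is accepted with a
probability small compared to the inverse dimension of the witness space. -/
theorem exists_measurement_without_witness {α κ : Type*} [Fintype α] [DecidableEq α] [Fintype κ]
    [DecidableEq κ] {E : Matrix (α × κ) (α × κ) ℂ} (hE : IsMeasurementOperator E) :
    ∃ L : Matrix α α ℂ, IsMeasurementOperator L ∧ ∀ ψ, IsPureState ψ →
      (∀ d : ℝ, (∀ φ, IsPureState φ → acceptProb E (tensorState ψ φ) ≤ d) →
        acceptProb L ψ ≤ 12 * (Fintype.card κ * d)) ∧
      (∀ φ, IsPureState φ → 1 - acceptProb E (tensorState ψ φ) ≤ 1 / 12 →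
        2 / 3 ≤ acceptProb L ψ) := by
  have hright : ∀ φ : κ → ℂ, ∃ R : Matrix (α × κ) α ℂ, ∀ v, R *ᵥ v = tensorState v φ := by
    intro φ
    refine ⟨Matrix.of fun p j => if p.1 = j then φ p.2 else 0, fun v => ?_⟩
    funext p
    simp [Matrix.mulVec, dotProduct, tensorState, mul_comm]
  choose R hR using hright
  set X : Matrix α α ℂ := ∑ i, (R (Pi.single i 1))ᴴ * E * R (Pi.single i 1) with hXdef
  have hX : X.PosSemidef :=
    Matrix.posSemidef_sum _ fun i _ => hE.1.conjTranspose_mul_mul_same _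
  have hXv : ∀ v, acceptProb X v = ∑ i, acceptProb E (tensorState v (Pi.single i 1)) := by
    intro v
    rw [hXdef, acceptProb_sum]
    exact Finset.sum_congr rfl fun i _ => by rw [acceptProb_conjTranspose_mul_mul, hR]
  have hc : (0 : ℝ) < 1 / 12 := by norm_num
  obtain ⟨N, hN, hNv⟩ := exists_resolvent hX hc
  have hz : ∀ v, ∃ z, (star z ⬝ᵥ v).re = acceptProb N v ∧
      acceptProb X z + 1 / 12 * acceptProb 1 z = 1 / 12 * acceptProb N v ∧
      acceptProb 1 v - acceptProb N v ≤ 12 * acceptProb X v := by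
    intro v
    obtain ⟨z, hz1, hz2⟩ := hNv v
    refine ⟨z, hz2, ?_, ?_⟩
    · have := congrArg (fun u => (star z ⬝ᵥ u).re) hz1
      simp only [dotProduct_add, dotProduct_smul, Complex.add_re, smul_eq_mul,
        Complex.re_ofReal_mul, hz2] at this
      rw [← this, acceptProb, acceptProb, Matrix.one_mulVec]
    · have hs := hX.add ((Matrix.PosSemidef.one (n := α) (R := ℂ)).smul
        (Complex.zero_le_real.2 hc.le))
      -- Since `(X + c) z = c v`, nonnegativity of the form `X + c` at `v - z` reads `c (‖v‖² - ⟨N⟩)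
      -- ≤ ⟨X⟩` at `v`.
      have h := acceptProb_nonneg hs (v - z)
      rw [acceptProb_vec_sub hs.isHermitian, Matrix.add_mulVec, Matrix.smul_mulVec,
        Matrix.one_mulVec, hz1] at h
      have h3 := congrArg (fun u => (star z ⬝ᵥ u).re) hz1
      simp only [dotProduct_add, dotProduct_smul, Complex.add_re, smul_eq_mul,
        Complex.re_ofReal_mul, hz2] at h3
      simp only [acceptProb_add, acceptProb_smul, dotProduct_smul, smul_eq_mul,
        Complex.re_ofReal_mul] at h
      have h4 : (star v ⬝ᵥ v).re = acceptProb 1 v := by rw [acceptProb, Matrix.one_mulVec]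
      have h5 : (star z ⬝ᵥ z).re = acceptProb 1 z := by rw [acceptProb, Matrix.one_mulVec]
      have h6 : (star z ⬝ᵥ (X *ᵥ z)).re = acceptProb X z := rfl
      rw [h4] at h
      rw [h5, h6] at h3
      linarith
  -- `1 - N = X(X + c)⁻¹` with `c = 1/12`; soundness is `1 - N ≤ X/c`.
  refine ⟨1 - N, ⟨?_, by simpa using hN⟩, fun ψ hψ => ⟨fun d hd => ?_, fun φ hφ h => ?_⟩⟩
  · refine posSemidef_of_acceptProb_nonneg (Matrix.isHermitian_one.sub hN.isHermitian) fun v => ?_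
    obtain ⟨z, hz1, hz2, -⟩ := hz v
    have h := two_mul_re_dotProduct_mulVec_le (Matrix.PosSemidef.one (n := α) (R := ℂ))
      one_pos z v
    rw [Matrix.one_mulVec, hz1] at h
    have := acceptProb_nonneg hX z
    rw [acceptProb_sub]
    linarith
  · obtain ⟨z, -, -, hz3⟩ := hz ψ
    rw [acceptProb_sub]
    refine hz3.trans (mul_le_mul_of_nonneg_left ?_ (by norm_num))
    rw [hXv, ← nsmul_eq_mul]
    exact Finset.sum_le_card_nsmul _ _ _ fun i _ => hd _ (isPureState_single i)
  · obtain ⟨z, hz1, hz2, -⟩ := hz ψ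
    set Q := (R φ)ᴴ * E * R φ with hQdef
    have hQ : Q.PosSemidef := hE.1.conjTranspose_mul_mul_same _
    have hQv : ∀ v, acceptProb Q v = acceptProb E (tensorState v φ) := fun v => by
      rw [hQdef, acceptProb_conjTranspose_mul_mul, hR]
    have hQX : acceptProb Q z ≤ acceptProb X z := by
      rw [hQv, hXv, ← acceptProb_contract]
      simp only [← acceptProb_contract E z]
      exact acceptProb_le_sum_single (contract_posSemidef hE.1 z) hφ
    have hQ1 : (1 - Q).PosSemidef := by
      refine posSemidef_of_acceptProb_nonneg (Matrix.isHermitian_one.sub hQ.isHermitian)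
        fun v => ?_
      have h1 := acceptProb_le_of_posSemidef_sub hE.2 (tensorState v φ)
      have h2 := acceptProb_kronecker (Matrix.isHermitian_one (n := α) (α := ℂ))
        (B := (1 : Matrix κ κ ℂ)) v φ
      rw [Matrix.one_kronecker_one, hφ.acceptProb_one, mul_one] at h2
      rw [acceptProb_sub, hQv]
      linarith
    -- Split `⟨z, ψ⟩ = ⟨N⟩` along `Q + (1 - Q)`. The weights 6 and 1/2 are in ratio `1 : c`, so with
    -- `Q ≤ X` the terms in `z` total at most `6⟨X⟩ + ‖z‖²/2 = ⟨N⟩/2`. The terms in `ψ` total at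
    -- most `1/6 + 11/72`, so `⟨N⟩ ≤ 23/108 < 1/3`.
    have h1 := two_mul_re_dotProduct_mulVec_le hQ (r := 6) (by norm_num) z ψ
    have h2 := two_mul_re_dotProduct_mulVec_le hQ1 (r := 1 / 2) (by norm_num) z ψ
    have h3 : (star z ⬝ᵥ ((1 - Q) *ᵥ ψ)).re =
        (star z ⬝ᵥ ψ).re - (star z ⬝ᵥ (Q *ᵥ ψ)).re := by
      rw [Matrix.sub_mulVec, Matrix.one_mulVec, dotProduct_sub, Complex.sub_re]
    have h4 := acceptProb_nonneg hX z
    have h5 := acceptProb_nonneg hQ z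
    rw [h3, hz1, acceptProb_sub, acceptProb_sub, hψ.acceptProb_one] at h2
    rw [hQv ψ] at h1 h2
    have h6 : acceptProb E (tensorState ψ φ) ≤ 1 := by
      rw [← (hψ.tensorState hφ).acceptProb_one]
      exact acceptProb_le_of_posSemidef_sub hE.2 _
    rw [acceptProb_sub, hψ.acceptProb_one]
    norm_num at h1 h2
    linarith

end RemoveWitness

/-! ### Choice of parameters -/

section Main

/-- Threshold `k` out of `2k` gives error `(8/9)^k` on both sides: `2^(-k) (4/3)^(2k)` and `2^k
(2/3)^(2k)`. Gentle measurement with `b = 1/(24r)` loses `2br = 1/12`. The last hypothesis is `12 ·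
D · 3^(-r) ≤ 1/3` for witness dimension `D`. -/
theorem Q1_le_of_merlinProtocol {n m a w k r : ℕ} {f : PartialBoolFun n m}
    (P : MerlinProtocol n m a w) (hP : P.Verifies f) (hr : 0 < r)
    (hk : (8 / 9 : ℝ) ^ k ≤ 1 / 3) (hkr : (8 / 9 : ℝ) ^ k ≤ (1 / (24 * r)) ^ 2)
    (hwr : 36 * ((2 : ℝ) ^ (w * (2 * k)) * (1 / 3) ^ r) ≤ 1) :
    Q1 f ≤ a * (2 * k) * r := by
  obtain ⟨β, κ, _, _, _, _, T, hβ, hκ, hT, hth⟩ :=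
    exists_threshold_amplification (Bits a) (Bits w) (2 * k)
  obtain ⟨γ, _, _, S, hγ, hS, hseq⟩ := exists_sequential_amplification β κ r
  choose E hEm hE using fun y => hth (P.measure y) (P.measure_isMeasurement y)
  choose F hFm hF using fun y => hseq (E y k) (hEm y k)
  choose L hLm hL using fun y => exists_measurement_without_witness (hFm y)
  have hcard : Fintype.card (Bits (a * (2 * k) * r)) = Fintype.card γ := by
    rw [hγ, hβ, ← pow_mul]
    simp [pow_mul]
  have e : Bits (a * (2 * k) * r) ≃ γ := Fintype.equivOfCardEq hcard
  have hpow : ∀ c : ℝ, c ^ (2 * k) = (c ^ 2) ^ k := fun c => pow_mul c 2 k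
  refine Nat.sInf_le ⟨⟨fun x => S (T (P.message x)) ∘ e,
    fun x => (hS _ (hT _ (P.message_pure x))).comp_equiv e,
    fun y => (L y).submatrix e e, fun y => (hLm y).submatrix e⟩, fun x y => ⟨fun h => ?_,
    fun h => ?_⟩⟩
  · obtain ⟨φ, hφ, hacc⟩ := (hP x y).1 h
    obtain ⟨Φ, hΦ, hΦk⟩ := (hE y _ (P.message_pure x)).2 φ hφ hacc
    have h1 : 1 - acceptProb (E y k) (tensorState (T (P.message x)) Φ) ≤ (1 / (24 * r)) ^ 2 := by
      refine (hΦk k).trans (le_trans (le_of_eq ?_) hkr)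
      rw [hpow, ← mul_pow]
      norm_num
    have hr' : (0 : ℝ) < r := by exact_mod_cast hr
    have h2 := (hF y _ (hT _ (P.message_pure x))).2 (1 / (24 * r)) (by positivity) Φ hΦ h1
    rw [acceptProb_submatrix]
    refine (hL y _ (hS _ (hT _ (P.message_pure x)))).2 Φ hΦ (h2.trans (le_of_eq ?_))
    field_simp
    norm_num
  · have h1 : ∀ Φ, IsPureState Φ →
        acceptProb (E y k) (tensorState (T (P.message x)) Φ) ≤ 1 / 3 := by
      intro Φ hΦ
      refine ((hE y _ (P.message_pure x)).1 ((hP x y).2 h) k Φ hΦ).trans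
        (le_trans (le_of_eq ?_) hk)
      rw [hpow, ← inv_pow, ← mul_pow]
      norm_num
    have h2 := (hL y _ (hS _ (hT _ (P.message_pure x)))).1 _
      ((hF y _ (hT _ (P.message_pure x))).1 h1)
    have h3 : (Fintype.card κ : ℝ) = 2 ^ (w * (2 * k)) := by
      rw [hκ]
      simp [pow_mul]
    rw [h3] at h2
    rw [acceptProb_submatrix]
    linarith

/-- The right side is only polynomially small in `w`, so `k` of order `log w` suffices. As `(8/9)^6
< 1/2`, the left side is at most `2^(-40l)`, while `(24r)² ≤ 2^(4l + 32) ≤ 2^(40l)` because `l ≥ 1`.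
-/
theorem pow_eight_ninths_le {w : ℕ} (hw : 2 ≤ w) :
    (8 / 9 : ℝ) ^ (240 * Nat.log 2 w) ≤
      (1 / (24 * ((4 * (240 * Nat.log 2 w) * w : ℕ) : ℝ))) ^ 2 := by
  set l := Nat.log 2 w with hl
  have hl1 : 1 ≤ l := Nat.log_pos one_lt_two hw
  have hlt : w < 2 ^ (l + 1) := Nat.lt_pow_succ_log_self one_lt_two w
  have hlw : l < 2 ^ l := Nat.lt_two_pow_self
  have h1 : (24 * (4 * (240 * l) * w)) ^ 2 ≤ 2 ^ (40 * l) := by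
    calc (24 * (4 * (240 * l) * w)) ^ 2 ≤ (2 ^ 15 * (2 ^ l * 2 ^ (l + 1))) ^ 2 := by
          refine Nat.pow_le_pow_left ?_ 2
          calc 24 * (4 * (240 * l) * w) = 23040 * (l * w) := by ring
            _ ≤ 2 ^ 15 * (2 ^ l * 2 ^ (l + 1)) :=
              Nat.mul_le_mul (by norm_num) (Nat.mul_le_mul hlw.le hlt.le)
      _ = 2 ^ (4 * l + 32) := by ring
      _ ≤ 2 ^ (40 * l) := Nat.pow_le_pow_right two_pos (by omega)
  have h2 : (8 / 9 : ℝ) ^ (240 * l) ≤ (1 / 2) ^ (40 * l) := by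
    rw [show 240 * l = 6 * (40 * l) by ring, pow_mul]
    exact pow_le_pow_left₀ (by norm_num) (by norm_num) _
  have hw0 : (0 : ℝ) < w := by exact_mod_cast (by omega : 0 < w)
  have hl0 : (0 : ℝ) < l := by exact_mod_cast hl1
  have h3 : (24 * ((4 * (240 * l) * w : ℕ) : ℝ)) ^ 2 ≤ 2 ^ (40 * l) := by exact_mod_cast h1
  refine h2.trans ?_
  rw [one_div, one_div, inv_pow, inv_pow]
  exact inv_anti₀ (by push_cast; positivity) h3

end Main

theorem mainTheorem6 :
    ∃ C : ℝ, 0 < C ∧ ∀ (n m : ℕ) (f : PartialBoolFun n m) (w : ℕ), 2 ≤ w →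
      (Q1 f : ℝ) ≤ C * ((QMA1 w f : ℝ) * (w : ℝ) * Real.log (w : ℝ) ^ 2) := by
  refine ⟨4 * (8 * 240 ^ 2), by norm_num, fun n m f w hw => ?_⟩
  obtain ⟨P, hP⟩ := Nat.sInf_mem (QMA1_nonempty w f)
  change MerlinProtocol n m (QMA1 w f) w at P
  set l := Nat.log 2 w with hl
  have hl1 : 1 ≤ l := Nat.log_pos one_lt_two hw
  have hr : 0 < 4 * (240 * l) * w := by positivity
  have hk : (8 / 9 : ℝ) ^ (240 * l) ≤ 1 / 3 :=
    (pow_le_pow_of_le_one (by norm_num) (by norm_num) (by omega : 10 ≤ 240 * l)).trans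
      (by norm_num)
  have hwr : 36 * ((2 : ℝ) ^ (w * (2 * (240 * l))) * (1 / 3) ^ (4 * (240 * l) * w)) ≤ 1 := by
    have h : (2 : ℝ) ^ (w * (2 * (240 * l))) * (1 / 3) ^ (4 * (240 * l) * w) =
        (4 / 81) ^ (240 * l * w) := by
      rw [show w * (2 * (240 * l)) = 2 * (240 * l * w) by ring,
        show 4 * (240 * l) * w = 4 * (240 * l * w) by ring, pow_mul (2 : ℝ) 2,
        pow_mul (1 / 3 : ℝ) 4, ← mul_pow]
      norm_num
    rw [h]
    have h2 : (4 / 81 : ℝ) ^ (240 * l * w) ≤ (4 / 81) ^ 2 :=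
      pow_le_pow_of_le_one (by norm_num) (by norm_num) (by nlinarith)
    norm_num at h2 ⊢
    linarith
  have h := Q1_le_of_merlinProtocol P hP hr hk (pow_eight_ninths_le hw) hwr
  -- Base 2 to natural logarithm: `1 / log 2 < 2`.
  have hlog : (l : ℝ) ≤ 2 * Real.log w := by
    have h1 : (2 : ℝ) ^ l ≤ w := by exact_mod_cast Nat.pow_log_le_self 2 (by omega)
    have h2 := Real.log_le_log (by positivity) h1
    rw [Real.log_pow] at h2
    nlinarith [Real.log_two_gt_d9, (Nat.cast_nonneg l : (0 : ℝ) ≤ l)]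
  have hlsq : (l : ℝ) ^ 2 ≤ 4 * Real.log w ^ 2 := by
    calc (l : ℝ) ^ 2 ≤ (2 * Real.log w) ^ 2 := pow_le_pow_left₀ (Nat.cast_nonneg l) hlog 2
      _ = 4 * Real.log w ^ 2 := by ring
  calc (Q1 f : ℝ) ≤ ((QMA1 w f * (2 * (240 * l)) * (4 * (240 * l) * w) : ℕ) : ℝ) := by
        exact_mod_cast h
    _ = 8 * 240 ^ 2 * (QMA1 w f * w) * (l : ℝ) ^ 2 := by
        push_cast
        ring
    _ ≤ 8 * 240 ^ 2 * (QMA1 w f * w) * (4 * Real.log w ^ 2) :=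
        mul_le_mul_of_nonneg_left hlsq (by positivity)
    _ = _ := by ring
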